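/- **Setting.** Fix a function-free first-order signature (without equality) with set of predicate symbols $\mathbf P$ and set of constants $\Delta$ (standard names: constants denote themselves and quantifiers range over $\Delta$). Formulae are built from atoms by $\lnot,\land,\exists$ and the modal operators $\mathbf K,\mathbf{not}$. An interpretation is a set of ground atoms; $\mathcal I$ is the set of all of them; an MKNF interpretation is a nonempty $M\subseteq\mathcal I$. A ground atom is true in $(I,M,N)$ iff it belongs to $I$; $\lnot,\land,\exists$ are as usual; $\mathbf K\phi$ holds in $(I,M,N)$ iff $\phi$ holds in $(J,M,N)$ for all $J\in M$, and $\mathbf{not}\,\phi$ iff $\phi$ fails in $(J,M,N)$ for some $J\in N$. For $M\subseteq\mathcal I$ and a set $T$ of sentences, $M\models T$ means that every $\phi\in T$ holds in $(I,M,M)$ for all $I\in M$; $\mathsf{mod}(T)$ is the greatest $M\subseteq\mathcal I$ with $M\models T$ (it exists for first-order $T$). $\mathsf{pr}(\cdot)$ denotes the set of predicate symbols occurring in an expression. *Minimal change update.* Write $J\le_I J'$ if for every $P\in\mathbf P$ the set of $P$-atoms on which $I,J$ differ is contained in the set of $P$-atoms on which $I,J'$ differ, and $J<_IJ'$ if $J\le_IJ'$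 and not $J'\le_IJ$. Put $M\oplus N=\bigcup_{I\in M}\{J\in N\mid \text{there is no } J'\in N \text{ with } J'<_IJ\}$. The minimal change update model of a finite sequence $\langle T_i\rangle_{i<n}$ of first-order theories is $(\cdots(\mathcal I\oplus\mathsf{mod}(T_0))\oplus\cdots)\oplus\mathsf{mod}(T_{n-1})$, if this set is nonempty (for $n=0$ it is $\mathcal I$). *Dynamic logic programs.* A literal is a ground atom $p$ or a default literal $\sim p$ (with $\sim\sim p=p$). A rule $r$ has a head literal $H(r)$ and a finite set $B(r)$ of body literals; it is positive if $H(r)$ is an atom, and a fact if $B(r)=\emptyset$. A program is a set of rules. For an interpretation $I$, $I\models p$ iff $p\in I$, and $I\models{\sim}p$ iff $p\notin I$. For a finite sequence $P=\langle P_i\rangle_{i<n}$ of programs, an occurrence of a rule $r\in P_i$ at position $i$ is rejected by $I$ if some $r'\in P_j$ with $i\le j$ has $H(r)={\sim}H(r')$ and $I\models B(r')$. $I$ is a dynamic stable model of $P$ if $I\cup\{\sim p\mid p\notin I\}$ is the least model, with the literals $\sim p$ treated as new atoms, of the program consisting of all rules with at least one non-rejected occurrence and the facts $\sim p$ for all ground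 atoms $p$ such that no rule $r$ of any $P_i$ has $H(r)=p$ and $I\models B(r)$. *Hybrid knowledge bases.* A description logic is given by a set of axioms $\phi$, each with a translation $\mathsf{fo}(\phi)$ into a first-order sentence; $\mathsf{pr}(\phi)=\mathsf{pr}(\mathsf{fo}(\phi))$. A hybrid knowledge base is a pair $\langle\mathcal O,\mathcal P\rangle$ of a set of axioms and a program; a dynamic one is a finite sequence $\mathcal K=\langle\mathcal K_i\rangle_{i<n}$ with $\mathcal K_i=\langle\mathcal O_i,\mathcal P_i\rangle$. $\mathcal K$ is $\mathcal O$-based if every $\mathcal P_i$ contains only positive facts, $\mathcal P$-based if every $\mathcal O_i$ is empty, and basic if it is one or the other. An MKNF interpretation $M$ is a *dynamic MKNF model* of a basic $\mathcal K$ if either $\mathcal K$ is $\mathcal O$-based and $M$ is the minimal change update model of $\langle\mathsf{fo}(\mathcal O_i)\cup\mathcal P_i\rangle_{i<n}$ (facts read as ground atoms), or $\mathcal K$ is $\mathcal P$-based and $M=\{J\in\mathcal I\mid I\subseteq J\}$ for some dynamic stable model $I$ of $\langle\mathcal P_i\rangle_{i<n}$. *Splitting.* $U\subseteq\mathbf P$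 is a splitting set for $\langle\mathcal O,\mathcal P\rangle$ if $\mathsf{pr}(\phi)\subseteq U$ for every $\phi\in\mathcal O$ with $\mathsf{pr}(\phi)\cap U\ne\emptyset$, and $\mathsf{pr}(r)\subseteq U$ for every $r\in\mathcal P$ with $\mathsf{pr}(H(r))\cap U\neq\emptyset$. The bottom $b_U$ keeps the axioms and rules whose predicate symbols all lie in $U$, and the top $t_U$ the others. For $X\subseteq\mathcal I$, $e_U(\langle\mathcal O,\mathcal P\rangle,X)$ consists of the axioms of the top and, for each rule $r$ of the top such that $X\models\mathbf Kp$ for every atom $p\in B(r)$ with predicate symbol in $U$ and $X\models\mathbf{not}\,p$ for every default literal ${\sim}p\in B(r)$ with predicate symbol in $U$, the rule with head $H(r)$ and body $\{L\in B(r)\mid\mathsf{pr}(L)\subseteq\mathbf P\setminus U\}$. A splitting sequence for a knowledge base is a sequence $\langle U_\alpha\rangle_{\alpha<\mu}$ of splitting sets, indexed by the ordinals below an ordinal $\mu$, that is monotone and continuous ($U_\alpha=\bigcup_{\eta<\alpha}U_\eta$ for limit ordinals $\alpha<\mu$) with $\bigcup_{\alpha<\mu}U_\alpha=\mathbf P$;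 for a dynamic $\mathcal K$ it has to be a splitting sequence for every $\mathcal K_i$, and $b_U$, $t_U$, $e_U$ are applied to each $\mathcal K_i$. A dynamic $\mathcal K$ is reducible relative to $V\subseteq\mathbf P$ if either all rules in all $\mathcal P_i$ are positive with $\mathsf{pr}(B(r))\subseteq V$, or all $\mathcal O_i$ are empty. A splitting sequence $U$ for $\mathcal K$ is update-enabling if $b_{U_0}(\mathcal K)$ is reducible relative to $\emptyset$ and $t_{U_\alpha}(b_{U_{\alpha+1}}(\mathcal K))$ is reducible relative to $U_\alpha$ whenever $\alpha+1<\mu$. An MKNF interpretation $M$ is a *dynamic MKNF model of $\mathcal K$ with respect to $U$* if $U$ is an update-enabling splitting sequence for $\mathcal K$ and $M=\bigcap_{\alpha<\mu}X_\alpha$ for some sequence $\langle X_\alpha\rangle_{\alpha<\mu}$ of MKNF interpretations such that $X_0$ is a dynamic MKNF model of $b_{U_0}(\mathcal K)$; $X_{\alpha+1}$ is a dynamic MKNF model of $e_{U_\alpha}\bigl(b_{U_{\alpha+1}}(\mathcal K),\bigcap_{\eta\le\alpha}X_\eta\bigr)$ whenever $\alpha+1<\mu$; and $X_\alpha=\mathcal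 I$ for every limit ordinal $\alpha<\mu$. **Corollary (compatibility).** Let $\mathcal K$ be a basic dynamic hybrid knowledge base and let $U=\langle U_\alpha\rangle_{\alpha<\mu}$ be a splitting sequence for $\mathcal K$. Then, for every $M\subseteq\mathcal I$, $M$ is a dynamic MKNF model of $\mathcal K$ if and only if $M$ is a dynamic MKNF model of $\mathcal K$ with respect to $U$. -/

import Mathlib

universe u v w x

namespace HybridMKNF

/-! ## Function-free first-order syntax with the modal operators `K` and `not` -/

/-- A function-free first-order signature: predicate symbols with arities, and constants.
Under the standard names assumption `Const` is the Herbrand universe `Δ`. -/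
structure Signature where
  Pred : Type u
  arity : Pred → ℕ
  Const : Type v

/-- Terms with `n` free variables. -/
inductive Term (S : Signature.{u, v}) (n : ℕ) : Type v
  | var (i : Fin n) : Term S n
  | const (c : S.Const) : Term S n

/-- MKNF formulae with free variables among `n` variables; `ex` binds the last one. -/
inductive Formula (S : Signature.{u, v}) : ℕ → Type (max u v)
  | atom {n : ℕ} (P : S.Pred) (ts : Fin (S.arity P) → Term S n) : Formula S n
  | neg {n : ℕ} (φ : Formula S n) : Formula S n
  | and {n : ℕ} (φ ψ : Formula S n) : Formula S n
  | ex {n : ℕ} (φ : Formula S (n + 1)) : Formula S n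
  | know {n : ℕ} (φ : Formula S n) : Formula S n
  | mnot {n : ℕ} (φ : Formula S n) : Formula S n

/-- Sentences: formulae without free variables. -/
abbrev Sentence (S : Signature.{u, v}) := Formula S 0

namespace Formula

/-- The set of predicate symbols relevant to a formula. -/
def preds {S : Signature.{u, v}} : {n : ℕ} → Formula S n → Set S.Pred
  | _, atom P _ => {P}
  | _, neg φ => preds φ
  | _, and φ ψ => preds φ ∪ preds ψ
  | _, ex φ => preds φ
  | _, know φ => preds φ
  | _, mnot φ => preds φ

/-- A formula is first-order if it contains no modal operators. -/
def IsFirstOrder {S : Signature.{u, v}} : {n : ℕ} → Formula S n → Prop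
  | _, atom _ _ => True
  | _, neg φ => IsFirstOrder φ
  | _, and φ ψ => IsFirstOrder φ ∧ IsFirstOrder ψ
  | _, ex φ => IsFirstOrder φ
  | _, know _ => False
  | _, mnot _ => False

end Formula

/-! ## Herbrand interpretations and MKNF satisfaction -/

/-- Ground atoms `P(c₁, …, cₖ)`. -/
structure GroundAtom (S : Signature.{u, v}) where
  pred : S.Pred
  args : Fin (S.arity pred) → S.Const

/-- A ground atom as a sentence. -/
def GroundAtom.toSentence {S : Signature.{u, v}} (p : GroundAtom S) : Sentence S :=
  Formula.atom p.pred (fun i => Term.const (p.args i))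

/-- A Herbrand interpretation is a set of ground atoms (those that are true in it). -/
abbrev Interp (S : Signature.{u, v}) := Set (GroundAtom S)

/-- The value of a term when constants are substituted for its variables. -/
def Term.eval {S : Signature.{u, v}} {n : ℕ} (e : Fin n → S.Const) : Term S n → S.Const
  | var i => e i
  | const c => c

/-- Satisfaction in the MKNF structure `(I, M, N)` of a formula in which the constants `e`
have been substituted for the free variables. -/
def Formula.Sat {S : Signature.{u, v}} (M N : Set (Interp S)) :
    {n : ℕ} → Interp S → (Fin n → S.Const) → Formula S n → Prop
  | _, I, e, atom P ts => GroundAtom.mk P (fun i => (ts i).eval e) ∈ I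
  | _, I, e, neg φ => ¬ Sat M N I e φ
  | _, I, e, and φ ψ => Sat M N I e φ ∧ Sat M N I e ψ
  | _, I, e, ex φ => ∃ c : S.Const, Sat M N I (Fin.snoc e c) φ
  | _, _, e, know φ => ∀ J ∈ M, Sat M N J e φ
  | _, _, e, mnot φ => ∃ J ∈ N, ¬ Sat M N J e φ

/-- `M ⊨ T` for a set `M` of interpretations and a set `T` of MKNF sentences. -/
def Models {S : Signature.{u, v}} (M : Set (Interp S)) (T : Set (Sentence S)) : Prop :=
  ∀ φ ∈ T, ∀ I ∈ M, φ.Sat M M I Fin.elim0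

/-- `M = mod(T)`: `M` is the greatest set of interpretations with `M ⊨ T`. -/
def IsMod {S : Signature.{u, v}} (T : Set (Sentence S)) (M : Set (Interp S)) : Prop :=
  IsGreatest {N | Models N T} M

/-! ## Minimal change update -/

/-- `diff(P, I, J)`. -/
def diff {S : Signature.{u, v}} (P : S.Pred) (I J : Interp S) : Set (GroundAtom S) :=
  ({p ∈ I | p.pred = P} \ {p ∈ J | p.pred = P}) ∪ ({p ∈ J | p.pred = P} \ {p ∈ I | p.pred = P})

/-- `J ≤_I J'`: `J` is at least as close to `I` as `J'`. -/
def CloserEq {S : Signature.{u, v}} (I J J' : Interp S) : Prop :=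
  ∀ P : S.Pred, diff P I J ⊆ diff P I J'

/-- `J <_I J'`: `J` is closer to `I` than `J'`. -/
def Closer {S : Signature.{u, v}} (I J J' : Interp S) : Prop :=
  CloserEq I J J' ∧ ¬ CloserEq I J' J

/-- `I ⊕ N` for an interpretation `I`. -/
def updateInterp {S : Signature.{u, v}} (I : Interp S) (N : Set (Interp S)) : Set (Interp S) :=
  {J ∈ N | ¬ ∃ J' ∈ N, Closer I J' J}

/-- `M ⊕ N` for a set of interpretations `M`. -/
def update {S : Signature.{u, v}} (M N : Set (Interp S)) : Set (Interp S) :=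
  ⋃ I ∈ M, updateInterp I N

/-- `(⋯((𝓘 ⊕ M₀) ⊕ M₁) ⊕ ⋯) ⊕ Mₙ₋₁`, where `𝓘` is the set of all interpretations. -/
def updateSeq {S : Signature.{u, v}} : (n : ℕ) → (Fin n → Set (Interp S)) → Set (Interp S)
  | 0, _ => Set.univ
  | k + 1, M => update (updateSeq k (fun i => M i.castSucc)) (M (Fin.last k))

/-- `M` is the minimal change update model of the sequence `T` of theories. -/
def IsMinimalChangeUpdateModel {S : Signature.{u, v}} {n : ℕ} (T : Fin n → Set (Sentence S))
    (M : Set (Interp S)) : Prop :=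
  M.Nonempty ∧ ∃ N : Fin n → Set (Interp S), (∀ i, IsMod (T i) (N i)) ∧ M = updateSeq n N

/-! ## Generalised and dynamic logic programs -/

/-- Literals: ground atoms and default literals. -/
inductive Literal (S : Signature.{u, v}) : Type (max u v)
  | pos (p : GroundAtom S) : Literal S
  | dneg (p : GroundAtom S) : Literal S

namespace Literal

/-- Default negation of a literal; double default negation is absorbed. -/
def lpnot {S : Signature.{u, v}} : Literal S → Literal S
  | pos p => dneg p
  | dneg p => pos p

/-- The predicate symbols occurring in a literal. -/
def preds {S : Signature.{u, v}} : Literal S → Set S.Pred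
  | pos p => {p.pred}
  | dneg p => {p.pred}

/-- `I ⊨ L`. -/
def Holds {S : Signature.{u, v}} (I : Interp S) : Literal S → Prop
  | pos p => p ∈ I
  | dneg p => p ∉ I

/-- The translation `π`: `π(p) = K p` and `π(not p) = not p`. -/
def toMKNF {S : Signature.{u, v}} : Literal S → Sentence S
  | pos p => Formula.know p.toSentence
  | dneg p => Formula.mnot p.toSentence

end Literal

/-- Ground rules `L₀ ← L₁, …, Lₖ`. -/
structure Rule (S : Signature.{u, v}) where
  head : Literal S
  body : Finset (Literal S)

namespace Rule

/-- Predicate symbols occurring in the body. -/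
def bodyPreds {S : Signature.{u, v}} (r : Rule S) : Set S.Pred := ⋃ L ∈ r.body, L.preds

/-- Predicate symbols occurring in the rule. -/
def preds {S : Signature.{u, v}} (r : Rule S) : Set S.Pred := r.head.preds ∪ r.bodyPreds

/-- The head is an atom. -/
def IsPositive {S : Signature.{u, v}} (r : Rule S) : Prop := ∃ p, r.head = Literal.pos p

/-- The body is empty. -/
def IsFact {S : Signature.{u, v}} (r : Rule S) : Prop := r.body = ∅

/-- `I ⊨ B(r)`. -/
def BodyHolds {S : Signature.{u, v}} (I : Interp S) (r : Rule S) : Prop :=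
  ∀ L ∈ r.body, L.Holds I

/-- `r ⋈ r'`: the heads are complementary. -/
def Conflicting {S : Signature.{u, v}} (r r' : Rule S) : Prop := r.head = r'.head.lpnot

end Rule

/-- The least model of a program in which each default literal `not p` is read as a fresh
atom; the literal `dneg p` itself plays the role of the fresh atom. -/
def least {S : Signature.{u, v}} (Q : Set (Rule S)) : Set (Literal S) :=
  ⋂₀ {A | ∀ r ∈ Q, (∀ L ∈ r.body, L ∈ A) → r.head ∈ A}

/-- `I' = I ∪ {not p | p ∉ I}`. -/
def withDefaults {S : Signature.{u, v}} (I : Interp S) : Set (Literal S) :=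
  {L | L.Holds I}

/-- `ρ(P)`: the multiset of all rules of `P`. A rule that belongs to several members of the
sequence occurs once for each of them, so an occurrence is a rule with its position. -/
def allRules {S : Signature.{u, v}} {n : ℕ} (P : Fin n → Set (Rule S)) :
    Set (Fin n × Rule S) :=
  {o | o.2 ∈ P o.1}

/-- `rej(P, I)`: the rejected rule occurrences. -/
def rejected {S : Signature.{u, v}} {n : ℕ} (P : Fin n → Set (Rule S)) (I : Interp S) :
    Set (Fin n × Rule S) :=
  {o | o.2 ∈ P o.1 ∧ ∃ (j : Fin n) (r' : Rule S),
    r' ∈ P j ∧ o.1 ≤ j ∧ o.2.Conflicting r' ∧ r'.BodyHolds I}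

/-- `def(P, I)`: the default assumptions, as facts. -/
def defaults {S : Signature.{u, v}} {n : ℕ} (P : Fin n → Set (Rule S)) (I : Interp S) :
    Set (Rule S) :=
  {d | ∃ p : GroundAtom S, d = ⟨Literal.dneg p, ∅⟩ ∧
    ¬ ∃ o ∈ allRules P, o.2.head = Literal.pos p ∧ o.2.BodyHolds I}

/-- `I` is a dynamic stable model of the dynamic logic program `P`. -/
def IsDynamicStableModel {S : Signature.{u, v}} {n : ℕ} (P : Fin n → Set (Rule S))
    (I : Interp S) : Prop :=
  withDefaults I = least (Prod.snd '' (allRules P \ rejected P I) ∪ defaults P I)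

/-! ## Hybrid knowledge bases -/

/-- A description logic: a language of ontology statements with a translation into
function-free first-order sentences. -/
structure DescriptionLogic (S : Signature.{u, v}) where
  Stmt : Type w
  fo : Stmt → Sentence S
  isFirstOrder_fo : ∀ φ, (fo φ).IsFirstOrder

/-- The predicate symbols relevant to an ontology statement. -/
def DescriptionLogic.preds {S : Signature.{u, v}} (D : DescriptionLogic.{u, v, w} S)
    (φ : D.Stmt) : Set S.Pred :=
  (D.fo φ).preds

/-- A hybrid knowledge base: an ontology and a generalised logic program. -/
structure HybridKB {S : Signature.{u, v}} (D : DescriptionLogic.{u, v, w} S) where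
  ont : Set D.Stmt
  prog : Set (Rule S)

namespace HybridKB

variable {S : Signature.{u, v}} {D : DescriptionLogic.{u, v, w} S}

/-- `U` is a splitting set for `K`. -/
def IsSplittingSet (K : HybridKB D) (U : Set S.Pred) : Prop :=
  (∀ φ ∈ K.ont, (D.preds φ ∩ U).Nonempty → D.preds φ ⊆ U) ∧
  (∀ r ∈ K.prog, (r.head.preds ∩ U).Nonempty → r.preds ⊆ U)

/-- The bottom `b_U(K)`. -/
def bottom (U : Set S.Pred) (K : HybridKB D) : HybridKB D where
  ont := {φ ∈ K.ont | D.preds φ ⊆ U}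
  prog := {r ∈ K.prog | r.preds ⊆ U}

/-- The top `t_U(K)`. -/
def top (U : Set S.Pred) (K : HybridKB D) : HybridKB D where
  ont := K.ont \ (bottom U K).ont
  prog := K.prog \ (bottom U K).prog

/-- The splitting set reduct `e_U(K, X)`. -/
def reduct (U : Set S.Pred) (K : HybridKB D) (X : Set (Interp S)) : HybridKB D where
  ont := (top U K).ont
  prog := {r' | ∃ r ∈ (top U K).prog,
    Models X (Literal.toMKNF '' {L | L ∈ r.body ∧ L.preds ⊆ U}) ∧
    r'.head = r.head ∧
    (r'.body : Set (Literal S)) = {L | L ∈ r.body ∧ L.preds ⊆ Uᶜ}}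

/-- Ontology-based: the program contains only positive facts. -/
def IsOntBased (K : HybridKB D) : Prop := ∀ r ∈ K.prog, r.IsPositive ∧ r.IsFact

/-- Program-based: the ontology is empty. -/
def IsProgBased (K : HybridKB D) : Prop := K.ont = ∅

/-- The first-order theory of an ontology-based knowledge base: the translated ontology
together with the atoms that are positive facts of the program. -/
def theory (K : HybridKB D) : Set (Sentence S) :=
  D.fo '' K.ont ∪ {φ | ∃ p : GroundAtom S, (⟨Literal.pos p, ∅⟩ : Rule S) ∈ K.prog ∧
    φ = p.toSentence}

/-- Ontology-reducible relative to `U`. -/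
def IsOntReducible (U : Set S.Pred) (K : HybridKB D) : Prop :=
  ∀ r ∈ K.prog, r.IsPositive ∧ r.bodyPreds ⊆ U

/-- Program-reducible (relative to any set). -/
def IsProgReducible (K : HybridKB D) : Prop := K.ont = ∅

/-- `⟨U_α⟩_{α < μ}` is a splitting sequence for `K`; only the values of `U` below `μ` matter. -/
structure IsSplittingSequence (K : HybridKB D) (μ : Ordinal.{x})
    (U : Ordinal.{x} → Set S.Pred) : Prop where
  splitting : ∀ α < μ, K.IsSplittingSet (U α)
  monotone : ∀ α β, α ≤ β → β < μ → U α ⊆ U β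
  continuous : ∀ α < μ, Order.IsSuccLimit α → U α = ⋃ η < α, U η
  cover : ⋃ α < μ, U α = Set.univ

end HybridKB

/-! ## Dynamic hybrid knowledge bases -/

/-- A dynamic hybrid knowledge base of length `n`. -/
abbrev DynamicHybridKB {S : Signature.{u, v}} (D : DescriptionLogic.{u, v, w} S) (n : ℕ) :=
  Fin n → HybridKB D

namespace DynamicHybridKB

variable {S : Signature.{u, v}} {D : DescriptionLogic.{u, v, w} S} {n : ℕ}

def bottom (U : Set S.Pred) (K : DynamicHybridKB D n) : DynamicHybridKB D n :=
  fun i => (K i).bottom U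

def top (U : Set S.Pred) (K : DynamicHybridKB D n) : DynamicHybridKB D n :=
  fun i => (K i).top U

def reduct (U : Set S.Pred) (K : DynamicHybridKB D n) (X : Set (Interp S)) :
    DynamicHybridKB D n :=
  fun i => (K i).reduct U X

def IsOntBased (K : DynamicHybridKB D n) : Prop := ∀ i, (K i).IsOntBased

def IsProgBased (K : DynamicHybridKB D n) : Prop := ∀ i, (K i).IsProgBased

def IsBasic (K : DynamicHybridKB D n) : Prop := K.IsOntBased ∨ K.IsProgBased

/-- `M` is a dynamic MKNF model of the basic dynamic hybrid knowledge base `K`. -/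
def IsDynamicMKNFModel (K : DynamicHybridKB D n) (M : Set (Interp S)) : Prop :=
  M.Nonempty ∧
  ((K.IsOntBased ∧ IsMinimalChangeUpdateModel (fun i => (K i).theory) M) ∨
   (K.IsProgBased ∧ ∃ I : Interp S, IsDynamicStableModel (fun i => (K i).prog) I ∧
      M = {J | I ⊆ J}))

def IsSplittingSequence (K : DynamicHybridKB D n) (μ : Ordinal.{x})
    (U : Ordinal.{x} → Set S.Pred) : Prop :=
  ∀ i, (K i).IsSplittingSequence μ U

/-- Reducible relative to `U`: ontology-reducible or program-reducible. -/
def IsReducible (U : Set S.Pred) (K : DynamicHybridKB D n) : Prop :=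
  (∀ i, (K i).IsOntReducible U) ∨ (∀ i, (K i).IsProgReducible)

/-- `⟨U_α⟩_{α < μ}` is an update-enabling splitting sequence for `K`. -/
structure IsUpdateEnabling (K : DynamicHybridKB D n) (μ : Ordinal.{x})
    (U : Ordinal.{x} → Set S.Pred) : Prop where
  splitting : K.IsSplittingSequence μ U
  zero : 0 < μ → IsReducible ∅ (K.bottom (U 0))
  succ : ∀ α, α + 1 < μ → IsReducible (U α) ((K.bottom (U (α + 1))).top (U α))

/-- `⟨X_α⟩_{α < μ}` is a solution to `K` with respect to `⟨U_α⟩_{α < μ}`. -/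
structure IsSolution (K : DynamicHybridKB D n) (μ : Ordinal.{x})
    (U : Ordinal.{x} → Set S.Pred) (X : Ordinal.{x} → Set (Interp S)) : Prop where
  nonempty : ∀ α < μ, (X α).Nonempty
  zero : 0 < μ → IsDynamicMKNFModel (K.bottom (U 0)) (X 0)
  succ : ∀ α, α + 1 < μ →
    IsDynamicMKNFModel ((K.bottom (U (α + 1))).reduct (U α) (⋂ η ≤ α, X η)) (X (α + 1))
  limit : ∀ α < μ, Order.IsSuccLimit α → X α = Set.univ

/-- `M` is a dynamic MKNF model of `K` with respect to the update-enabling splitting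
sequence `⟨U_α⟩_{α < μ}`. -/
def IsDynamicMKNFModelWrt (K : DynamicHybridKB D n) (μ : Ordinal.{x})
    (U : Ordinal.{x} → Set S.Pred) (M : Set (Interp S)) : Prop :=
  K.IsUpdateEnabling μ U ∧ M.Nonempty ∧
    ∃ X : Ordinal.{x} → Set (Interp S), K.IsSolution μ U X ∧ M = ⋂ α < μ, X α

end DynamicHybridKB

end HybridMKNF

/-!
A predicate symbol enters a splitting sequence at a unique index, its level. The axioms and facts
of an `𝒪`-based knowledge base then fall apart into theories whose models depend on the atoms of a
single level only, and closeness of interpretations is decided level by level, so that minimal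
change update acts on every level separately. In a `𝒫`-based knowledge base no body literal lies
on a higher level than the head, so that the least model can be computed level by level, the lower
levels being evaluated in the bodies; rejection and default assumptions depend on the level of the
head only. In either case a model is exactly an intersection of models of the levels, each relative
to the lower ones. By continuity no predicate symbol has a limit ordinal as its level, which matches
the condition `X α = univ` on solutions at limits.
-/

namespace HybridMKNF

/-! ## Models of first-order theories -/

section FirstOrder

variable {S : Signature.{u, v}}

lemma Formula.preds_nonempty {n : ℕ} (φ : Formula S n) : φ.preds.Nonempty := by
  induction φ with
  | atom P ts => exact ⟨P, rfl⟩
  | and _ _ ih _ => exact ih.mono Set.subset_union_left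
  | neg _ ih | ex _ ih | know _ ih | mnot _ ih => exact ih

lemma Formula.IsFirstOrder.sat_congr {n : ℕ} {φ : Formula S n} (hφ : φ.IsFirstOrder)
    {M N M' N' : Set (Interp S)} {I J : Interp S} (e : Fin n → S.Const)
    (h : ∀ p : GroundAtom S, p.pred ∈ φ.preds → (p ∈ I ↔ p ∈ J)) :
    φ.Sat M N I e ↔ φ.Sat M' N' J e := by
  induction φ with
  | atom P ts => exact h _ rfl
  | neg _ ih => exact not_congr (ih hφ e h)
  | and _ _ ih₁ ih₂ =>
    exact and_congr (ih₁ hφ.1 e fun p hp => h p (Or.inl hp))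
      (ih₂ hφ.2 e fun p hp => h p (Or.inr hp))
  | ex _ ih => exact exists_congr fun _ => ih hφ _ h
  | know => exact hφ.elim
  | mnot => exact hφ.elim

/-- The interpretations in which every sentence of a theory `T` is true. For first-order `T` this
is `mod(T)`, and the modal components of the structure, here `𝓘`, are irrelevant. -/
def foModels (T : Set (Sentence S)) : Set (Interp S) :=
  {I | ∀ φ ∈ T, φ.Sat Set.univ Set.univ I Fin.elim0}

lemma models_iff_subset_foModels {T : Set (Sentence S)} (hT : ∀ φ ∈ T, φ.IsFirstOrder)
    {M : Set (Interp S)} : Models M T ↔ M ⊆ foModels T :=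
  ⟨fun h _ hI φ hφ => ((hT φ hφ).sat_congr _ fun _ _ => Iff.rfl).1 (h φ hφ _ hI),
    fun h φ hφ _ hI => ((hT φ hφ).sat_congr _ fun _ _ => Iff.rfl).1 (h hI φ hφ)⟩

lemma isMod_iff_eq_foModels {T : Set (Sentence S)} (hT : ∀ φ ∈ T, φ.IsFirstOrder)
    {M : Set (Interp S)} : IsMod T M ↔ M = foModels T := by
  have hgreatest : IsMod T (foModels T) :=
    ⟨(models_iff_subset_foModels hT).2 subset_rfl, fun _ => (models_iff_subset_foModels hT).1⟩
  exact ⟨fun h => h.unique hgreatest, fun h => h ▸ hgreatest⟩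

lemma isMinimalChangeUpdateModel_iff {n : ℕ} {T : Fin n → Set (Sentence S)}
    (hT : ∀ i, ∀ φ ∈ T i, φ.IsFirstOrder) {M : Set (Interp S)} :
    IsMinimalChangeUpdateModel T M ↔
      M.Nonempty ∧ M = updateSeq n fun i => foModels (T i) := by
  simp only [IsMinimalChangeUpdateModel, isMod_iff_eq_foModels (hT _), ← funext_iff,
    exists_eq_left]

lemma foModels_image_toSentence (F : Set (GroundAtom S)) :
    foModels (GroundAtom.toSentence '' F) = Set.Ici F :=
  Set.ext fun _ => Set.forall_mem_image

lemma foModels_iUnion {ι : Type*} (T : ι → Set (Sentence S)) :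
    foModels (⋃ a, T a) = ⋂ a, foModels (T a) := by
  ext I
  simp only [foModels, Set.mem_iUnion, Set.mem_iInter, Set.mem_ofPred_eq]
  exact ⟨fun h a φ hφ => h φ ⟨a, hφ⟩, fun h φ ⟨a, hφ⟩ => h a φ hφ⟩

end FirstOrder

/-! ## Minimal change update along a partition of the ground atoms -/

section Fibers

variable {α ι : Type*} (f : α → ι)

lemma iUnion_inter_fiber (s : Set α) : ⋃ a, s ∩ f ⁻¹' {a} = s := by
  ext
  simp

lemma iUnion_inter_fiber_inter_fiber (s : ι → Set α) (a : ι) :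
    (⋃ b, s b ∩ f ⁻¹' {b}) ∩ f ⁻¹' {a} = s a ∩ f ⁻¹' {a} := by
  ext x
  simp only [Set.mem_inter_iff, Set.mem_iUnion, Set.mem_preimage, Set.mem_singleton_iff]
  constructor
  · rintro ⟨⟨b, hx, rfl⟩, rfl⟩
    exact ⟨hx, rfl⟩
  · rintro ⟨hx, rfl⟩
    exact ⟨⟨_, hx, rfl⟩, rfl⟩

end Fibers

section Update

variable {S : Signature.{u, v}}

lemma closerEq_iff_symmDiff_subset {I J J' : Interp S} :
    CloserEq I J J' ↔ symmDiff I J ⊆ symmDiff I J' := by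
  have hdiff : ∀ P (L : Interp S), diff P I L = symmDiff I L ∩ {p | p.pred = P} := fun P L =>
    (Set.inter_symmDiff_distrib_right ..).symm
  simp only [CloserEq, hdiff]
  exact ⟨fun h p hp => (h p.pred ⟨hp, rfl⟩).1, fun h P => Set.inter_subset_inter_left _ h⟩

lemma CloserEq.rfl {I J : Interp S} : CloserEq I J J :=
  closerEq_iff_symmDiff_subset.2 subset_rfl

lemma closerEq_self_left (I J : Interp S) : CloserEq I I J := by
  simp [closerEq_iff_symmDiff_subset]

lemma CloserEq.inter {I J J' : Interp S} (h : CloserEq I J J') (B : Set (GroundAtom S)) :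
    CloserEq (I ∩ B) (J ∩ B) (J' ∩ B) := by
  rw [closerEq_iff_symmDiff_subset] at h ⊢
  simpa only [← Set.inter_symmDiff_distrib_right] using Set.inter_subset_inter_left B h

lemma closerEq_iff_forall_inter {ι : Sort*} {B : ι → Set (GroundAtom S)}
    (hB : ⋃ a, B a = Set.univ) {I J J' : Interp S} :
    CloserEq I J J' ↔ ∀ a, CloserEq (I ∩ B a) (J ∩ B a) (J' ∩ B a) := by
  refine ⟨fun h a => h.inter _, fun h => closerEq_iff_symmDiff_subset.2 fun p hp => ?_⟩
  obtain ⟨a, ha⟩ := Set.mem_iUnion.1 (hB.symm ▸ Set.mem_univ p)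
  have h' := closerEq_iff_symmDiff_subset.1 (h a)
  rw [← Set.inter_symmDiff_distrib_right, ← Set.inter_symmDiff_distrib_right] at h'
  exact (h' ⟨hp, ha⟩).1

lemma closerEq_iff_inter_and_inter_compl (B : Set (GroundAtom S)) {I J J' : Interp S} :
    CloserEq I J J' ↔ CloserEq (I ∩ B) (J ∩ B) (J' ∩ B) ∧
      CloserEq (I ∩ Bᶜ) (J ∩ Bᶜ) (J' ∩ Bᶜ) := by
  have hcover : ⋃ b : Bool, (bif b then B else Bᶜ) = Set.univ := by
    rw [← Set.union_eq_iUnion, Set.union_compl_self]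
  rw [closerEq_iff_forall_inter hcover, Bool.forall_bool, and_comm, cond_true, cond_false]

lemma mem_update {M N : Set (Interp S)} {J : Interp S} :
    J ∈ update M N ↔ ∃ I ∈ M, J ∈ N ∧ ∀ L ∈ N, CloserEq I L J → CloserEq I J L := by
  simp only [update, updateInterp, Closer, Set.mem_iUnion, exists_prop, Set.mem_ofPred_eq,
    not_exists, not_and, not_not]

/-- `N` is saturated relative to the set `B` of ground atoms: whether an interpretation belongs to
`N` depends only on its atoms in `B`. -/
def IsSaturated (B : Set (GroundAtom S)) (N : Set (Interp S)) : Prop :=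
  ∀ ⦃I J : Interp S⦄, I ∩ B = J ∩ B → I ∈ N → J ∈ N

lemma isSaturated_univ (B : Set (GroundAtom S)) : IsSaturated B Set.univ :=
  fun _ _ _ _ => trivial

lemma isSaturated_foModels {T : Set (Sentence S)} (hT : ∀ φ ∈ T, φ.IsFirstOrder)
    {B : Set (GroundAtom S)} (hB : ∀ φ ∈ T, ∀ p : GroundAtom S, p.pred ∈ φ.preds → p ∈ B) :
    IsSaturated B (foModels T) := fun I J hIJ hI φ hφ =>
  ((hT φ hφ).sat_congr _ fun p hp => by
    simpa [hB φ hφ p hp] using congrArg (p ∈ ·) hIJ).1 (hI φ hφ)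

variable {B : Set (GroundAtom S)} {M N : Set (Interp S)}

lemma IsSaturated.mem_congr (hN : IsSaturated B N) {I J : Interp S} (h : I ∩ B = J ∩ B) :
    I ∈ N ↔ J ∈ N :=
  ⟨hN h, hN h.symm⟩

lemma IsSaturated.mem_update (hM : IsSaturated B M) (hN : IsSaturated B N) {J : Interp S} :
    J ∈ update M N ↔ ∃ I ∈ M, J ∈ N ∧
      ∀ L ∈ N, CloserEq (I ∩ B) (L ∩ B) (J ∩ B) → CloserEq (I ∩ B) (J ∩ B) (L ∩ B) := by
  rw [HybridMKNF.mem_update]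
  constructor
  · rintro ⟨I, hI, hJ, hmin⟩
    refine ⟨I, hI, hJ, fun L hL hLJ => ?_⟩
    have hmix := Set.ite_inter_self B L I
    have hcloser : CloserEq I (B.ite L I) J := by
      rw [closerEq_iff_inter_and_inter_compl B, hmix, Set.ite_inter_compl_self]
      exact ⟨hLJ, closerEq_self_left _ _⟩
    exact hmix ▸ (hmin _ (hN hmix.symm hL) hcloser).inter B
  · rintro ⟨I, hI, hJ, hmin⟩
    have hmix := Set.ite_inter_self B I J
    refine ⟨B.ite I J, hM hmix.symm hI, hJ, fun L hL hLJ => ?_⟩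
    rw [closerEq_iff_inter_and_inter_compl B, hmix, Set.ite_inter_compl_self]
    exact ⟨hmin L hL (hmix ▸ hLJ.inter B), closerEq_self_left _ _⟩

lemma IsSaturated.update (hM : IsSaturated B M) (hN : IsSaturated B N) :
    IsSaturated B (update M N) := fun I J hIJ hI => by
  rw [hM.mem_update hN] at hI ⊢
  rwa [← hIJ, ← hN.mem_congr hIJ]

lemma IsSaturated.updateSeq {n : ℕ} {N : Fin n → Set (Interp S)}
    (hN : ∀ i, IsSaturated B (N i)) : IsSaturated B (updateSeq n N) := by
  induction n with
  | zero => exact isSaturated_univ B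
  | succ k ih => exact (ih fun i => hN i.castSucc).update (hN (Fin.last k))

variable {ι : Type*} {ℓ : GroundAtom S → ι}

lemma update_iInter {M N : ι → Set (Interp S)} (hM : ∀ a, IsSaturated (ℓ ⁻¹' {a}) (M a))
    (hN : ∀ a, IsSaturated (ℓ ⁻¹' {a}) (N a)) :
    update (⋂ a, M a) (⋂ a, N a) = ⋂ a, update (M a) (N a) := by
  classical
  have hcloser := @closerEq_iff_forall_inter S ι (fun a => ℓ ⁻¹' {a}) (by ext; simp)
  ext J
  simp only [mem_update (M := ⋂ a, M a), Set.mem_iInter, (hM _).mem_update (hN _)]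
  constructor
  · rintro ⟨I, hI, hJ, hmin⟩ a
    refine ⟨I, hI a, hJ a, fun L hL hLJ => ?_⟩
    -- The competitor `L` on level `a` extends by `J` to a competitor on all levels.
    set L' := ⋃ b, Function.update (fun _ => J) a L b ∩ ℓ ⁻¹' {b}
    have hL'a : L' ∩ ℓ ⁻¹' {a} = L ∩ ℓ ⁻¹' {a} := by
      simp [L', iUnion_inter_fiber_inter_fiber]
    have hL'b : ∀ b ≠ a, L' ∩ ℓ ⁻¹' {b} = J ∩ ℓ ⁻¹' {b} := fun b hb => by
      simp [L', iUnion_inter_fiber_inter_fiber, hb]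
    have hL'N : ∀ b, L' ∈ N b := fun b => by
      rcases eq_or_ne b a with rfl | hb
      · exact hN _ hL'a.symm hL
      · exact hN _ (hL'b b hb).symm (hJ b)
    have hL'J : CloserEq I L' J := hcloser.2 fun b => by
      rcases eq_or_ne b a with rfl | hb
      · rwa [hL'a]
      · rw [hL'b b hb]
        exact .rfl
    exact hL'a ▸ (hmin L' hL'N hL'J).inter (ℓ ⁻¹' {a})
  · intro h
    choose I hI hJ hmin using h
    have hglue := iUnion_inter_fiber_inter_fiber ℓ I
    refine ⟨_, fun a => hM a (hglue a).symm (hI a), hJ, fun L hL hLJ => hcloser.2 fun a => ?_⟩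
    have hLJa := hcloser.1 hLJ a
    rw [hglue] at hLJa ⊢
    exact hmin a L (hL a) hLJa

lemma updateSeq_iInter {n : ℕ} {N : Fin n → ι → Set (Interp S)}
    (hN : ∀ i a, IsSaturated (ℓ ⁻¹' {a}) (N i a)) :
    updateSeq n (fun i => ⋂ a, N i a) = ⋂ a, updateSeq n fun i => N i a := by
  induction n with
  | zero => exact Set.iInter_univ.symm
  | succ k ih =>
    simp only [updateSeq]
    rw [ih fun i => hN i.castSucc]
    exact update_iInter (fun a => .updateSeq fun i => hN i.castSucc a) (hN (Fin.last k))

lemma update_Ici (F G : Set (GroundAtom S)) :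
    update (Set.Ici F) (Set.Ici G) = Set.Ici (F ∪ G) := by
  ext J
  rw [mem_update]
  constructor
  · rintro ⟨I, hFI, hGJ, hmin⟩
    have hcloser : CloserEq I (I ∪ G) J := closerEq_iff_symmDiff_subset.2 fun p hp => by
      have := @hGJ p
      simp only [Set.mem_symmDiff, Set.mem_union] at hp ⊢
      tauto
    have hJ := closerEq_iff_symmDiff_subset.1 (hmin _ Set.subset_union_right hcloser)
    refine Set.union_subset (fun p hp => ?_) hGJ
    by_contra hpJ
    simpa [Set.mem_symmDiff, hFI hp] using hJ (Or.inl ⟨hFI hp, hpJ⟩)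
  · intro hJ
    exact ⟨J, Set.subset_union_left.trans hJ, Set.subset_union_right.trans hJ,
      fun L _ _ => closerEq_self_left _ _⟩

lemma updateSeq_Ici {n : ℕ} (F : Fin n → Set (GroundAtom S)) :
    updateSeq n (fun i => Set.Ici (F i)) = Set.Ici (⋃ i, F i) := by
  induction n with
  | zero => simp [updateSeq, ← Set.bot_eq_empty]
  | succ k ih =>
    simp only [updateSeq]
    rw [ih fun i => F i.castSucc, update_Ici]
    congr 1
    ext p
    simp [Fin.exists_fin_succ', or_comm]

end Update

/-! ## Least models of programs -/

section Programs

variable {S : Signature.{u, v}} {n : ℕ}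

namespace Literal

/-- The ground atom `p` of the literals `p` and `∼p`. -/
def atom : Literal S → GroundAtom S
  | pos p => p
  | dneg p => p

lemma preds_eq (L : Literal S) : L.preds = {L.atom.pred} := by cases L <;> rfl

lemma atom_lpnot (L : Literal S) : L.lpnot.atom = L.atom := by cases L <;> rfl

lemma lpnot_lpnot (L : Literal S) : L.lpnot.lpnot = L := by cases L <;> rfl

lemma holds_inter_iff {I : Interp S} {B : Set (GroundAtom S)} {L : Literal S}
    (hL : L.atom ∈ B) : L.Holds (I ∩ B) ↔ L.Holds I := by
  cases L with
  | pos p => exact and_iff_left hL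
  | dneg p => exact not_congr (and_iff_left hL)

end Literal

lemma withDefaults_injective : Function.Injective (withDefaults (S := S)) := fun _ _ h =>
  Set.ext fun p => Set.ext_iff.1 h (.pos p)

lemma withDefaults_inter (I : Interp S) (B : Set (GroundAtom S)) :
    withDefaults (I ∩ B) = withDefaults I ∩ Literal.atom ⁻¹' B ∪ Literal.dneg '' Bᶜ := by
  ext L
  cases L with
  | pos p => simp [withDefaults, Literal.Holds, Literal.atom]
  | dneg p =>
    simp only [withDefaults, Literal.Holds, Literal.atom, Set.mem_ofPred_eq, Set.mem_inter_iff,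
      Set.mem_union, Set.mem_preimage, Set.mem_image, Set.mem_compl_iff, Literal.dneg.injEq,
      exists_eq_right]
    tauto

/-- `A` is a model of the program `Q`, in which every literal is read as an atom. -/
def IsLiteralModel (Q : Set (Rule S)) (A : Set (Literal S)) : Prop :=
  ∀ r ∈ Q, (∀ L ∈ r.body, L ∈ A) → r.head ∈ A

variable {Q : Set (Rule S)} {A : Set (Literal S)}

lemma IsLiteralModel.least_subset (h : IsLiteralModel Q A) : least Q ⊆ A :=
  Set.sInter_subset_of_mem h

lemma isLiteralModel_least (Q : Set (Rule S)) : IsLiteralModel Q (least Q) := fun r hr hb =>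
  Set.mem_sInter.2 fun _ hA => hA r hr fun L hL => IsLiteralModel.least_subset hA (hb L hL)

lemma least_subset_head_image (Q : Set (Rule S)) : least Q ⊆ Rule.head '' Q :=
  IsLiteralModel.least_subset fun r hr _ => ⟨r, hr, rfl⟩

lemma least_of_forall_isFact (hQ : ∀ r ∈ Q, r.IsFact) : least Q = Rule.head '' Q := by
  refine (least_subset_head_image Q).antisymm (Set.image_subset_iff.2 fun r hr => ?_)
  exact isLiteralModel_least Q r hr (by simp [show r.body = ∅ from hQ r hr])

lemma least_union_facts {F : Set (Literal S)} (hF : ∀ r ∈ Q, ∀ L ∈ r.body, L ∉ F) :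
    least (Q ∪ (fun L => ⟨L, ∅⟩) '' F) = least Q ∪ F := by
  refine (IsLiteralModel.least_subset ?_).antisymm (Set.union_subset ?_ fun L hL => ?_)
  · rintro r (hr | ⟨L, hL, rfl⟩) hb
    · exact Or.inl <| isLiteralModel_least Q r hr fun L hL => (hb L hL).resolve_right (hF r hr L hL)
    · exact Or.inr hL
  · exact IsLiteralModel.least_subset fun r hr => isLiteralModel_least _ r (Or.inl hr)
  · exact isLiteralModel_least _ ⟨L, ∅⟩ (Or.inr ⟨L, hL, rfl⟩) (by simp)

open Classical in
/-- The rule `r` without the body literals whose atoms lie outside `B`. -/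
noncomputable def Rule.restrictBody (B : Set (GroundAtom S)) (r : Rule S) : Rule S :=
  ⟨r.head, r.body.filter fun L => L.atom ∈ B⟩

lemma Rule.mem_body_restrictBody {B : Set (GroundAtom S)} {r : Rule S} {L : Literal S} :
    L ∈ (r.restrictBody B).body ↔ L ∈ r.body ∧ L.atom ∈ B := by
  simp [Rule.restrictBody]

lemma Rule.restrictBody_eq_iff {B : Set (GroundAtom S)} {r r' : Rule S} :
    r.restrictBody B = r' ↔
      r'.head = r.head ∧ (r'.body : Set (Literal S)) = {L | L ∈ r.body ∧ L.atom ∈ B} := by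
  cases r'
  simp [restrictBody, ← Finset.coe_inj, eq_comm]

lemma Rule.IsFact.restrictBody {r : Rule S} (hr : r.IsFact) (B : Set (GroundAtom S)) :
    r.restrictBody B = r := by
  simp [restrictBody_eq_iff, show r.body = ∅ from hr]

end Programs

/-! ## Splitting a program into levels -/

section Levels

variable {S : Signature.{u, v}} {ι : Type*} [PartialOrder ι] {ℓ : GroundAtom S → ι}

/-- The part of the program `Q` on level `α`, when the atoms have levels `ℓ` and `T` is the set of
literals known to be true on lower levels: of each rule with head on level `α`, the body literals
on lower levels are evaluated in `T` and only those on level `α` are kept. -/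
noncomputable def levelProgram (ℓ : GroundAtom S → ι) (Q : Set (Rule S)) (α : ι)
    (T : Set (Literal S)) : Set (Rule S) :=
  Rule.restrictBody (ℓ ⁻¹' {α}) ''
    {r ∈ Q | ℓ r.head.atom = α ∧ ∀ L ∈ r.body, ℓ L.atom < α → L ∈ T}

/-- No body literal lies on a higher level than the head. -/
def IsLeveled (ℓ : GroundAtom S → ι) (Q : Set (Rule S)) : Prop :=
  ∀ r ∈ Q, ∀ L ∈ r.body, ℓ L.atom ≤ ℓ r.head.atom

variable {Q : Set (Rule S)} {α : ι} {T T' : Set (Literal S)}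

lemma levelProgram_congr (h : ∀ L : Literal S, ℓ L.atom < α → (L ∈ T ↔ L ∈ T')) :
    levelProgram ℓ Q α T = levelProgram ℓ Q α T' := by
  have hbody : ∀ r : Rule S, (∀ L ∈ r.body, ℓ L.atom < α → L ∈ T) ↔
      ∀ L ∈ r.body, ℓ L.atom < α → L ∈ T' := fun r =>
    forall₂_congr fun L _ => forall_congr' (h L)
  simp only [levelProgram, hbody]

lemma atom_of_mem_least_levelProgram {L : Literal S} (hL : L ∈ least (levelProgram ℓ Q α T)) :
    ℓ L.atom = α := by
  obtain ⟨_, ⟨r, hr, rfl⟩, rfl⟩ := least_subset_head_image _ hL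
  exact hr.2.1

lemma IsLeveled.isLiteralModel_levelProgram (hQ : IsLeveled ℓ Q) {A : Set (Literal S)}
    (hA : IsLiteralModel Q A) (hT : ∀ L ∈ T, ℓ L.atom < α → L ∈ A) :
    IsLiteralModel (levelProgram ℓ Q α T) A := by
  rintro _ ⟨r, ⟨hr, hα, hlow⟩, rfl⟩ hb
  refine hA r hr fun L hL => ?_
  rcases (hα ▸ hQ r hr L hL).lt_or_eq with hlt | heq
  · exact hT L (hlow L hL hlt) hlt
  · exact hb L (Rule.mem_body_restrictBody.2 ⟨hL, heq⟩)

lemma head_mem_least_levelProgram {r : Rule S} (hr : r ∈ Q) (hα : ℓ r.head.atom = α)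
    (hT : ∀ L ∈ r.body, ℓ L.atom < α → L ∈ T)
    (hb : ∀ L ∈ r.body, ℓ L.atom = α → L ∈ least (levelProgram ℓ Q α T)) :
    r.head ∈ least (levelProgram ℓ Q α T) :=
  isLiteralModel_least _ (r.restrictBody _) ⟨r, ⟨hr, hα, hT⟩, rfl⟩ fun L hL => by
    obtain ⟨hLr, hLα⟩ := Rule.mem_body_restrictBody.1 hL
    exact hb L hLr hLα

lemma IsLeveled.least_inter_level (hQ : IsLeveled ℓ Q) (α : ι) :
    least Q ∩ {L | ℓ L.atom = α} = least (levelProgram ℓ Q α (least Q)) := by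
  have hmodel : IsLiteralModel Q
      {L ∈ least Q | ℓ L.atom = α → L ∈ least (levelProgram ℓ Q α (least Q))} :=
    fun r hr hb => ⟨isLiteralModel_least Q r hr fun L hL => (hb L hL).1, fun hα =>
      head_mem_least_levelProgram hr hα (fun L hL _ => (hb L hL).1) fun L hL => (hb L hL).2⟩
  have hle : IsLiteralModel (levelProgram ℓ Q α (least Q)) (least Q) :=
    hQ.isLiteralModel_levelProgram (isLiteralModel_least Q) fun _ hL _ => hL
  exact Set.Subset.antisymm (fun _ hL => (hmodel.least_subset hL.1).2 hL.2)
    fun _ hL => ⟨hle.least_subset hL, atom_of_mem_least_levelProgram hL⟩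

lemma isLiteralModel_of_levels
    (h : ∀ α, T ∩ {L | ℓ L.atom = α} = least (levelProgram ℓ Q α T)) : IsLiteralModel Q T := by
  intro r hr hb
  refine ((h _).ge (head_mem_least_levelProgram hr rfl (fun L hL _ => hb L hL) ?_)).1
  exact fun L hL hα => (h _).le ⟨hb L hL, hα⟩

lemma IsLeveled.subset_least_of_levels [WellFoundedLT ι] (hQ : IsLeveled ℓ Q)
    (h : ∀ α, T ∩ {L | ℓ L.atom = α} = least (levelProgram ℓ Q α T)) : T ⊆ least Q := by
  suffices ∀ α, T ∩ {L | ℓ L.atom = α} ⊆ least Q from fun L hL => this _ ⟨hL, rfl⟩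
  intro α
  induction α using WellFoundedLT.induction with
  | ind α ih =>
    rw [h α]
    exact (hQ.isLiteralModel_levelProgram (isLiteralModel_least Q) fun L hL hα =>
      ih _ hα ⟨hL, rfl⟩).least_subset

theorem IsLeveled.eq_least_iff [WellFoundedLT ι] (hQ : IsLeveled ℓ Q) :
    T = least Q ↔ ∀ α, T ∩ {L | ℓ L.atom = α} = least (levelProgram ℓ Q α T) := by
  constructor
  · rintro rfl
    exact hQ.least_inter_level
  · exact fun h => (hQ.subset_least_of_levels h).antisymm (isLiteralModel_of_levels h).least_subset

end Levels

/-! ## Dynamic logic programs -/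

section Dynamic

variable {S : Signature.{u, v}} {n : ℕ}

/-- Some rule of `P` has head `H` and a body that holds in `I`. -/
def Fires (P : Set (Rule S)) (I : Interp S) (H : Literal S) : Prop :=
  ∃ r ∈ P, r.head = H ∧ r.BodyHolds I

/-- The program whose least model is compared with `I` in the definition of dynamic stable
models: the rules with a non-rejected occurrence and the default assumptions. -/
def activeRules (P : Fin n → Set (Rule S)) (I : Interp S) : Set (Rule S) :=
  Prod.snd '' (allRules P \ rejected P I) ∪ defaults P I

variable {P : Fin n → Set (Rule S)} {I : Interp S}

lemma isDynamicStableModel_iff_activeRules :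
    IsDynamicStableModel P I ↔ withDefaults I = least (activeRules P I) :=
  Iff.rfl

lemma mem_activeRules {r : Rule S} :
    r ∈ activeRules P I ↔
      (∃ i, r ∈ P i ∧ ∀ j, i ≤ j → ¬ Fires (P j) I r.head.lpnot) ∨
      ∃ p, r = ⟨.dneg p, ∅⟩ ∧ ∀ j, ¬ Fires (P j) I (.pos p) := by
  have hconflict : ∀ r' : Rule S, r.Conflicting r' ↔ r'.head = r.head.lpnot := fun r' =>
    ⟨fun h => by rw [show r.head = _ from h, Literal.lpnot_lpnot],
      fun h => by rw [Rule.Conflicting, h, Literal.lpnot_lpnot]⟩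
  refine or_congr ?_ (exists_congr fun p => and_congr_right fun _ => ?_)
  · simp only [allRules, rejected, Fires, hconflict, Set.mem_image, Set.mem_sdiff,
      Set.mem_ofPred_eq, Prod.exists, exists_eq_right]
    refine exists_congr fun i => and_congr_right fun hr => ?_
    simp only [hr, true_and, not_exists, not_and]
    exact ⟨fun h j hij r' hr' => h j r' hr' hij, fun h j r' hr' hij => h j hij r' hr'⟩
  · simp only [allRules, Fires, Set.mem_ofPred_eq, Prod.exists, not_exists, not_and]

lemma IsDynamicStableModel.exists_head (h : IsDynamicStableModel P I) {p : GroundAtom S}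
    (hp : p ∈ I) : ∃ i, ∃ r ∈ P i, r.head = .pos p := by
  obtain ⟨r, hr, hrp⟩ := least_subset_head_image _ (h.subset (show Literal.pos p ∈ _ from hp))
  rcases mem_activeRules.1 hr with ⟨i, hri, -⟩ | ⟨q, rfl, -⟩
  · exact ⟨i, r, hri, hrp⟩
  · cases hrp

lemma fires_iff_of_forall_isFact {P : Set (Rule S)} (hP : ∀ r ∈ P, r.IsFact) {H : Literal S} :
    Fires P I H ↔ ⟨H, ∅⟩ ∈ P := by
  refine ⟨?_, fun h => ⟨_, h, rfl, by simp [Rule.BodyHolds]⟩⟩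
  rintro ⟨⟨H, B⟩, hr, rfl, -⟩
  obtain rfl : B = ∅ := hP _ hr
  exact hr

lemma least_activeRules_of_forall_isFact (hP : ∀ i, ∀ r ∈ P i, r.IsPositive ∧ r.IsFact) :
    least (activeRules P I) = withDefaults (⋃ i, {p | (⟨.pos p, ∅⟩ : Rule S) ∈ P i}) := by
  have hfires : ∀ i H, Fires (P i) I H ↔ ⟨H, ∅⟩ ∈ P i := fun i _ =>
    fires_iff_of_forall_isFact fun r hr => (hP i r hr).2
  have hneg : ∀ i p, (⟨.dneg p, ∅⟩ : Rule S) ∉ P i := fun i p h => by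
    obtain ⟨q, hq⟩ := (hP i _ h).1
    cases hq
  have hactive : ∀ r ∈ activeRules P I, r.IsFact := fun r hr => by
    rcases mem_activeRules.1 hr with ⟨i, hri, -⟩ | ⟨q, rfl, -⟩
    · exact (hP i r hri).2
    · rfl
  rw [least_of_forall_isFact hactive]
  ext L
  constructor
  · rintro ⟨⟨H, B⟩, hr, rfl⟩
    obtain rfl : B = ∅ := hactive _ hr
    rcases mem_activeRules.1 hr with ⟨i, hri, -⟩ | ⟨p, heq, hp⟩
    · obtain ⟨p, rfl⟩ := (hP i _ hri).1
      exact Set.mem_iUnion.2 ⟨i, hri⟩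
    · obtain rfl : H = .dneg p := congrArg Rule.head heq
      exact fun hpF => (Set.mem_iUnion.1 hpF).elim fun i hi => hp i ((hfires i _).2 hi)
  · cases L with
    | pos p =>
      intro hp
      obtain ⟨i, hi⟩ := Set.mem_iUnion.1 hp
      exact ⟨_, mem_activeRules.2 (Or.inl ⟨i, hi, fun j _ hj => hneg j p ((hfires j _).1 hj)⟩), rfl⟩
    | dneg p =>
      intro hp
      exact ⟨_, mem_activeRules.2 (Or.inr ⟨p, rfl, fun j hj =>
        hp (Set.mem_iUnion.2 ⟨j, (hfires j _).1 hj⟩)⟩), rfl⟩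

lemma isDynamicStableModel_iff_of_forall_isFact (hP : ∀ i, ∀ r ∈ P i, r.IsPositive ∧ r.IsFact) :
    IsDynamicStableModel P I ↔ I = ⋃ i, {p | (⟨.pos p, ∅⟩ : Rule S) ∈ P i} := by
  rw [isDynamicStableModel_iff_activeRules, least_activeRules_of_forall_isFact hP,
    withDefaults_injective.eq_iff]

section Level

variable {ι : Type*} [PartialOrder ι] {ℓ : GroundAtom S → ι}

lemma isLeveled_activeRules (hP : ∀ i, IsLeveled ℓ (P i)) : IsLeveled ℓ (activeRules P I) := by
  intro r hr
  rcases mem_activeRules.1 hr with ⟨i, hri, -⟩ | ⟨q, rfl, -⟩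
  · exact hP i r hri
  · simp

lemma IsLeveled.fires_levelProgram_iff {P : Set (Rule S)} (hP : IsLeveled ℓ P) {α : ι}
    {H : Literal S} (hH : ℓ H.atom = α) :
    Fires (levelProgram ℓ P α (withDefaults I)) (I ∩ ℓ ⁻¹' {α}) H ↔ Fires P I H := by
  constructor
  · rintro ⟨_, ⟨r, ⟨hr, hα, hlow⟩, rfl⟩, rfl, hb⟩
    refine ⟨r, hr, rfl, fun L hL => ?_⟩
    rcases (hα ▸ hP r hr L hL).lt_or_eq with hlt | heq
    · exact hlow L hL hlt
    · exact (Literal.holds_inter_iff heq).1 (hb L (Rule.mem_body_restrictBody.2 ⟨hL, heq⟩))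
  · rintro ⟨r, hr, rfl, hb⟩
    refine ⟨_, ⟨r, ⟨hr, hH, fun L hL _ => hb L hL⟩, rfl⟩, rfl, fun L hL => ?_⟩
    obtain ⟨hLr, hLα⟩ := Rule.mem_body_restrictBody.1 hL
    exact (Literal.holds_inter_iff hLα).2 (hb L hLr)

lemma Fires.level {P : Set (Rule S)} {α : ι} {T : Set (Literal S)} {H : Literal S}
    (h : Fires (levelProgram ℓ P α T) I H) : ℓ H.atom = α := by
  obtain ⟨_, ⟨r, ⟨-, hα, -⟩, rfl⟩, rfl, -⟩ := h
  exact hα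

lemma activeRules_levelProgram (hP : ∀ i, IsLeveled ℓ (P i)) (α : ι) :
    activeRules (fun i => levelProgram ℓ (P i) α (withDefaults I)) (I ∩ ℓ ⁻¹' {α}) =
      levelProgram ℓ (activeRules P I) α (withDefaults I) ∪
        (fun L => ⟨L, ∅⟩) '' (Literal.dneg '' (ℓ ⁻¹' {α})ᶜ) := by
  have hfires : ∀ j {H : Literal S}, ℓ H.atom = α → (¬ Fires
      (levelProgram ℓ (P j) α (withDefaults I)) (I ∩ ℓ ⁻¹' {α}) H ↔ ¬ Fires (P j) I H) :=
    fun j _ hH => not_congr ((hP j).fires_levelProgram_iff hH)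
  ext r
  rw [mem_activeRules]
  constructor
  · rintro (⟨i, ⟨r, ⟨hr, hα, hlow⟩, rfl⟩, hrej⟩ | ⟨p, rfl, hp⟩)
    · refine Or.inl ⟨r, ⟨mem_activeRules.2 (Or.inl ⟨i, hr, fun j hij => ?_⟩), hα, hlow⟩, rfl⟩
      exact (hfires j (r.head.atom_lpnot ▸ hα)).1 (hrej j hij)
    · by_cases hα : ℓ p = α
      · exact Or.inl ⟨_, ⟨mem_activeRules.2 (Or.inr ⟨p, rfl, fun j =>
          (hfires j (H := .pos p) hα).1 (hp j)⟩), hα, by simp⟩,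
          Rule.IsFact.restrictBody (r := ⟨.dneg p, ∅⟩) rfl _⟩
      · exact Or.inr ⟨_, ⟨p, hα, rfl⟩, rfl⟩
  · rintro (⟨r, ⟨hr, hα, hlow⟩, rfl⟩ | ⟨_, ⟨p, hα, rfl⟩, rfl⟩)
    · rcases mem_activeRules.1 hr with ⟨i, hri, hrej⟩ | ⟨p, rfl, hp⟩
      · exact Or.inl ⟨i, ⟨r, ⟨hri, hα, hlow⟩, rfl⟩, fun j hij =>
          (hfires j (r.head.atom_lpnot.symm ▸ hα)).2 (hrej j hij)⟩
      · exact Or.inr ⟨p, Rule.IsFact.restrictBody (r := ⟨.dneg p, ∅⟩) rfl _, fun j =>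
          (hfires j (H := .pos p) hα).2 (hp j)⟩
    · exact Or.inr ⟨p, rfl, fun j hj => hα hj.level⟩

theorem isDynamicStableModel_iff_forall_level [WellFoundedLT ι] (hP : ∀ i, IsLeveled ℓ (P i)) :
    IsDynamicStableModel P I ↔ ∀ α,
      IsDynamicStableModel (fun i => levelProgram ℓ (P i) α (withDefaults I))
        (I ∩ ℓ ⁻¹' {α}) := by
  rw [isDynamicStableModel_iff_activeRules, (isLeveled_activeRules hP).eq_least_iff]
  refine forall_congr' fun α => ?_
  set Q := levelProgram ℓ (activeRules P I) α (withDefaults I)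
  set F : Set (Literal S) := Literal.dneg '' (ℓ ⁻¹' {α})ᶜ
  have hF : ∀ L ∈ F, ℓ L.atom ≠ α := by
    rintro _ ⟨p, hp, rfl⟩
    exact hp
  have hbody : ∀ r ∈ Q, ∀ L ∈ r.body, L ∉ F := by
    rintro _ ⟨r, -, rfl⟩ L hL hLF
    exact hF L hLF (Rule.mem_body_restrictBody.1 hL).2
  have hleast : Disjoint (least Q) F := Set.disjoint_left.2 fun L hL hLF =>
    hF L hLF (atom_of_mem_least_levelProgram hL)
  have hlevel : Disjoint (withDefaults I ∩ {L | ℓ L.atom = α}) F :=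
    Set.disjoint_left.2 fun L hL hLF => hF L hLF hL.2
  rw [isDynamicStableModel_iff_activeRules, activeRules_levelProgram hP,
    least_union_facts hbody, withDefaults_inter]
  exact ⟨fun h => congrArg (· ∪ F) h,
    eq_of_inf_eq_sup_eq (hlevel.eq_bot.trans hleast.eq_bot.symm)⟩

end Level
end Dynamic

/-! ## Dynamic MKNF models of basic knowledge bases -/

section Basic

variable {S : Signature.{u, v}} {D : DescriptionLogic.{u, v, w} S} {n : ℕ}

namespace HybridKB

variable {K : HybridKB D}

lemma isFirstOrder_of_mem_theory {φ : Sentence S} (h : φ ∈ K.theory) : φ.IsFirstOrder := by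
  rcases h with ⟨ψ, -, rfl⟩ | ⟨p, -, rfl⟩
  · exact D.isFirstOrder_fo ψ
  · trivial

lemma IsProgBased.foModels_theory (hK : K.IsProgBased) :
    foModels K.theory = Set.Ici {p | (⟨.pos p, ∅⟩ : Rule S) ∈ K.prog} := by
  rw [← foModels_image_toSentence, theory, show K.ont = ∅ from hK, Set.image_empty,
    Set.empty_union]
  simp only [eq_comm, Set.image, Set.mem_ofPred_eq]

end HybridKB

namespace DynamicHybridKB

variable {K : DynamicHybridKB D n} {M : Set (Interp S)}

lemma exists_isDynamicStableModel_iff_eq_updateSeq (hO : K.IsOntBased) (hP : K.IsProgBased) :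
    (∃ I, IsDynamicStableModel (fun i => (K i).prog) I ∧ M = Set.Ici I) ↔
      M = updateSeq n fun i => foModels (K i).theory := by
  simp only [isDynamicStableModel_iff_of_forall_isFact hO, exists_eq_left,
    (hP _).foModels_theory, updateSeq_Ici]

lemma isDynamicMKNFModel_iff : K.IsDynamicMKNFModel M ↔ M.Nonempty ∧
    ((K.IsOntBased ∧ M = updateSeq n fun i => foModels (K i).theory) ∨
      (K.IsProgBased ∧ ∃ I, IsDynamicStableModel (fun i => (K i).prog) I ∧ M = Set.Ici I)) := by
  rw [IsDynamicMKNFModel,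
    isMinimalChangeUpdateModel_iff fun i _ => HybridKB.isFirstOrder_of_mem_theory]
  exact and_congr_right fun hM => or_congr (and_congr_right fun _ => and_iff_right hM) Iff.rfl

lemma isDynamicMKNFModel_iff_of_isOntBased (hK : K.IsOntBased) :
    K.IsDynamicMKNFModel M ↔ M.Nonempty ∧ M = updateSeq n fun i => foModels (K i).theory := by
  rw [isDynamicMKNFModel_iff]
  refine and_congr_right fun _ => ⟨?_, fun h => Or.inl ⟨hK, h⟩⟩
  rintro (⟨-, h⟩ | ⟨hP, h⟩)
  · exact h
  · exact (exists_isDynamicStableModel_iff_eq_updateSeq hK hP).1 h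

lemma isDynamicMKNFModel_iff_of_isProgBased (hK : K.IsProgBased) :
    K.IsDynamicMKNFModel M ↔
      ∃ I, IsDynamicStableModel (fun i => (K i).prog) I ∧ M = Set.Ici I := by
  rw [isDynamicMKNFModel_iff]
  constructor
  · rintro ⟨-, ⟨hO, h⟩ | ⟨-, h⟩⟩
    · exact (exists_isDynamicStableModel_iff_eq_updateSeq hO hK).2 h
    · exact h
  · rintro ⟨I, hI, rfl⟩
    exact ⟨Set.nonempty_Ici, Or.inr ⟨hK, I, hI, rfl⟩⟩

lemma isDynamicMKNFModel_iff_of_forall_empty (hO : ∀ i, (K i).ont = ∅)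
    (hP : ∀ i, (K i).prog = ∅) : K.IsDynamicMKNFModel M ↔ M = Set.univ := by
  have hfacts : ∀ i, ∀ r ∈ (K i).prog, r.IsPositive ∧ r.IsFact := by simp [hP]
  have hbot : (⋃ i, {p | (⟨.pos p, ∅⟩ : Rule S) ∈ (K i).prog}) = ⊥ := by simp [hP]
  simp only [isDynamicMKNFModel_iff_of_isProgBased hO,
    isDynamicStableModel_iff_of_forall_isFact hfacts, exists_eq_left, hbot, Set.Ici_bot]

lemma IsBasic.isUpdateEnabling (hK : K.IsBasic) {μ : Ordinal.{x}} {U : Ordinal.{x} → Set S.Pred}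
    (hU : K.IsSplittingSequence μ U) : K.IsUpdateEnabling μ U := by
  have hont : K.IsOntBased → ∀ i, ∀ r ∈ (K i).prog, ∀ V, r.IsPositive ∧ r.bodyPreds ⊆ V :=
    fun hO i r hr V => ⟨(hO i r hr).1, by simp [Rule.bodyPreds, show r.body = ∅ from (hO i r hr).2]⟩
  have hprog : K.IsProgBased → ∀ i, ∀ O ⊆ (K i).ont, O = ∅ := fun hP i O hO =>
    Set.subset_empty_iff.1 (hO.trans (hP i).subset)
  exact ⟨hU, fun _ => hK.imp (fun hO i r hr => hont hO i r hr.1 _)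
      fun hP i => hprog hP i _ fun _ hφ => hφ.1,
    fun α _ => hK.imp (fun hO i r hr => hont hO i r hr.1.1 _)
      fun hP i => hprog hP i _ fun _ hφ => hφ.1.1⟩

end DynamicHybridKB

end Basic

/-! ## Splitting a knowledge base into levels -/

section Splitting

variable {S : Signature.{u, v}} {D : DescriptionLogic.{u, v, w} S} {n : ℕ}

lemma Rule.preds_subset_iff {r : Rule S} {V : Set S.Pred} :
    r.preds ⊆ V ↔ r.head.atom.pred ∈ V ∧ ∀ L ∈ r.body, L.atom.pred ∈ V := by
  simp only [Rule.preds, Rule.bodyPreds, Literal.preds_eq, Set.union_subset_iff,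
    Set.iUnion_subset_iff, Set.singleton_subset_iff]

lemma models_Ici_toMKNF_iff {I : Interp S} {A : Set (Literal S)} :
    Models (Set.Ici I) (Literal.toMKNF '' A) ↔ A ⊆ withDefaults I := by
  simp only [Models, Set.forall_mem_image]
  refine forall₂_congr fun L _ => ?_
  cases L with
  | pos p => exact ⟨fun h => h I Set.self_mem_Ici I Set.self_mem_Ici, fun h _ _ J hJ => hJ h⟩
  | dneg p =>
    constructor
    · intro h hpI
      obtain ⟨J, hJ, hpJ⟩ := h I Set.self_mem_Ici
      exact hpJ (hJ hpI)
    · exact fun h _ _ => ⟨I, Set.self_mem_Ici, h⟩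

variable {ι : Type*} [LinearOrder ι] {β : S.Pred → ι} {α : ι} {X : Set (Interp S)}

namespace HybridKB

/-- The part of `K` on level `α`, when the predicate symbols have levels `β` and `X` is the model
of the lower levels. -/
def level (K : HybridKB D) (β : S.Pred → ι) (α : ι) (X : Set (Interp S)) : HybridKB D :=
  (K.bottom (β ⁻¹' Set.Iic α)).reduct (β ⁻¹' Set.Iio α) X

/-- Each axiom of `K` lies on a single level and no body literal of a rule of `K` lies on a higher
level than the head, so that the predicate symbols up to any given level form a splitting set. -/
structure IsLevelMap (K : HybridKB D) (β : S.Pred → ι) : Prop where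
  ont : ∀ φ ∈ K.ont, ∀ Q ∈ D.preds φ, ∀ Q' ∈ D.preds φ, β Q = β Q'
  prog : IsLeveled (fun p => β p.pred) K.prog

variable {K : HybridKB D}

lemma IsLevelMap.level_ont (hβ : K.IsLevelMap β) :
    (K.level β α X).ont = {φ ∈ K.ont | D.preds φ ⊆ β ⁻¹' {α}} := by
  ext φ
  constructor
  · rintro ⟨⟨hφ, hle⟩, hlt⟩
    refine ⟨hφ, fun Q hQ => (le_antisymm (hle hQ) ?_ : β Q = α)⟩
    by_contra! h
    exact hlt ⟨⟨hφ, hle⟩, fun Q' hQ' => (hβ.ont φ hφ Q' hQ' Q hQ).trans_lt h⟩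
  · rintro ⟨hφ, h⟩
    refine ⟨⟨hφ, fun Q hQ => (h hQ : β Q = α).le⟩, fun h' => ?_⟩
    obtain ⟨Q, hQ⟩ := (D.fo φ).preds_nonempty
    exact (h'.2 hQ : β Q < α).ne (h hQ)

lemma IsLevelMap.mem_top_prog (hβ : K.IsLevelMap β) {r : Rule S} :
    r ∈ (top (β ⁻¹' Set.Iio α) (K.bottom (β ⁻¹' Set.Iic α))).prog ↔
      r ∈ K.prog ∧ β r.head.atom.pred = α := by
  constructor
  · rintro ⟨⟨hr, hle⟩, hlt⟩
    refine ⟨hr, le_antisymm (Rule.preds_subset_iff.1 hle).1 ?_⟩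
    by_contra! h
    exact hlt ⟨⟨hr, hle⟩, Rule.preds_subset_iff.2
      ⟨h, fun L hL => (hβ.prog r hr L hL).trans_lt h⟩⟩
  · rintro ⟨hr, h⟩
    exact ⟨⟨hr, Rule.preds_subset_iff.2 ⟨h.le, fun L hL => (hβ.prog r hr L hL).trans h.le⟩⟩,
      fun h' => (Rule.preds_subset_iff.1 h'.2).1.ne h⟩

lemma IsLevelMap.level_prog (hβ : K.IsLevelMap β) :
    (K.level β α X).prog = Rule.restrictBody ((fun p => β p.pred) ⁻¹' {α}) ''
      {r ∈ K.prog | β r.head.atom.pred = α ∧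
        Models X (Literal.toMKNF '' {L | L ∈ r.body ∧ β L.atom.pred < α})} := by
  ext r'
  refine exists_congr fun r => ?_
  rw [hβ.mem_top_prog, Set.mem_ofPred_eq, and_assoc, and_assoc, and_assoc]
  refine and_congr_right fun hr => and_congr_right fun hα => ?_
  have hle : ∀ L ∈ r.body, ¬ β L.atom.pred < α ↔ β L.atom.pred = α := fun L hL =>
    ⟨fun h => ((hβ.prog r hr L hL).trans_eq hα).eq_of_not_lt h, fun h => h.not_lt⟩
  have hbody : {L | L ∈ r.body ∧ L.preds ⊆ (β ⁻¹' Set.Iio α)ᶜ} =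
      {L | L ∈ r.body ∧ L.atom ∈ (fun p => β p.pred) ⁻¹' {α}} :=
    Set.ext fun L => and_congr_right fun hL => by
      simpa [Literal.preds_eq] using hle L hL
  have hlow : ∀ L : Literal S, L.preds ⊆ β ⁻¹' Set.Iio α ↔ β L.atom.pred < α := fun L => by
    simp [Literal.preds_eq]
  simp only [hbody, hlow, Rule.restrictBody_eq_iff]

lemma IsLevelMap.level_Ici_prog (hβ : K.IsLevelMap β) {I : Interp S} :
    (K.level β α (Set.Ici I)).prog =
      levelProgram (fun p => β p.pred) K.prog α (withDefaults I) := by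
  simp only [hβ.level_prog, models_Ici_toMKNF_iff, levelProgram, Set.subset_def, Set.mem_ofPred_eq,
    and_imp]

lemma IsOntBased.level_prog (hK : K.IsOntBased) (hβ : K.IsLevelMap β) :
    (K.level β α X).prog = {r ∈ K.prog | β r.head.atom.pred = α} := by
  rw [hβ.level_prog, Set.image_congr fun r hr => Rule.IsFact.restrictBody (hK r hr.1).2 _,
    Set.image_id']
  ext r
  refine and_congr_right fun hr => and_iff_left ?_
  simp [show r.body = ∅ from (hK r hr).2, Models]

lemma IsOntBased.level_theory (hK : K.IsOntBased) (hβ : K.IsLevelMap β) :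
    (K.level β α X).theory = {φ ∈ K.theory | φ.preds ⊆ β ⁻¹' {α}} := by
  ext φ
  simp only [theory, hβ.level_ont, hK.level_prog hβ]
  constructor
  · rintro (⟨ψ, ⟨hψ, hα⟩, rfl⟩ | ⟨p, ⟨hp, hα⟩, rfl⟩)
    · exact ⟨Or.inl ⟨ψ, hψ, rfl⟩, hα⟩
    · exact ⟨Or.inr ⟨p, hp, rfl⟩, Set.singleton_subset_iff.2 hα⟩
  · rintro ⟨⟨ψ, hψ, rfl⟩ | ⟨p, hp, rfl⟩, hα⟩
    · exact Or.inl ⟨ψ, ⟨hψ, hα⟩, rfl⟩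
    · exact Or.inr ⟨p, ⟨hp, hα rfl⟩, rfl⟩

lemma IsLevelMap.exists_preds_subset (hβ : K.IsLevelMap β) {φ : Sentence S}
    (hφ : φ ∈ K.theory) : ∃ α, φ.preds ⊆ β ⁻¹' {α} := by
  obtain ⟨Q, hQ⟩ := φ.preds_nonempty
  refine ⟨β Q, fun Q' hQ' => (?_ : β Q' = β Q)⟩
  rcases hφ with ⟨ψ, hψ, rfl⟩ | ⟨p, -, rfl⟩
  · exact hβ.ont ψ hψ Q' hQ' Q hQ
  · rw [Set.mem_singleton_iff.1 hQ', Set.mem_singleton_iff.1 hQ]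

lemma IsLevelMap.foModels_theory (hβ : K.IsLevelMap β) :
    foModels K.theory = ⋂ α, foModels {φ ∈ K.theory | φ.preds ⊆ β ⁻¹' {α}} := by
  rw [← foModels_iUnion]
  congr 1
  ext φ
  simp only [Set.mem_iUnion, Set.mem_ofPred_eq, exists_and_left]
  exact (and_iff_left_of_imp hβ.exists_preds_subset).symm

end HybridKB

namespace DynamicHybridKB

/-- The dynamic knowledge base of the parts of the members of `K` on level `α`. -/
def level (K : DynamicHybridKB D n) (β : S.Pred → ι) (α : ι) (X : Set (Interp S)) :
    DynamicHybridKB D n :=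
  fun i => (K i).level β α X

/-- Every `X α` is a dynamic MKNF model of the part of `K` on level `α`, relative to the models
`X η` of the lower levels. -/
def IsLevelSolution (K : DynamicHybridKB D n) (β : S.Pred → ι) (X : ι → Set (Interp S)) : Prop :=
  ∀ α, IsDynamicMKNFModel (K.level β α (⋂ η < α, X η)) (X α)

variable {K : DynamicHybridKB D n}

lemma isDynamicMKNFModel_level_iff_of_isOntBased (hK : K.IsOntBased)
    (hβ : ∀ i, (K i).IsLevelMap β) {M : Set (Interp S)} :
    (K.level β α X).IsDynamicMKNFModel M ↔
      M.Nonempty ∧ M = updateSeq n fun i => foModels {φ ∈ (K i).theory | φ.preds ⊆ β ⁻¹' {α}} := by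
  have hlevel : (K.level β α X).IsOntBased := fun i r hr =>
    hK i r (((hK i).level_prog (hβ i)).subset hr).1
  simp only [isDynamicMKNFModel_iff_of_isOntBased hlevel, level, (hK _).level_theory (hβ _)]

lemma isDynamicMKNFModel_iff_exists_isLevelSolution_of_isOntBased (hK : K.IsOntBased)
    (hβ : ∀ i, (K i).IsLevelMap β) {M : Set (Interp S)} :
    K.IsDynamicMKNFModel M ↔ M.Nonempty ∧ ∃ X, K.IsLevelSolution β X ∧ M = ⋂ α, X α := by
  have hsat : ∀ i α, IsSaturated ((fun p : GroundAtom S => β p.pred) ⁻¹' {α})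
      (foModels {φ ∈ (K i).theory | φ.preds ⊆ β ⁻¹' {α}}) := fun i α =>
    isSaturated_foModels (fun φ hφ => HybridKB.isFirstOrder_of_mem_theory hφ.1)
      fun φ hφ p hp => hφ.2 hp
  rw [isDynamicMKNFModel_iff_of_isOntBased hK]
  simp only [(hβ _).foModels_theory, updateSeq_iInter hsat, IsLevelSolution,
    isDynamicMKNFModel_level_iff_of_isOntBased hK hβ]
  refine and_congr_right fun hM => ⟨?_, ?_⟩
  · rintro rfl
    exact ⟨_, fun α => ⟨hM.mono (Set.iInter_subset _ α), rfl⟩, rfl⟩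
  · rintro ⟨X, hX, rfl⟩
    exact Set.iInter_congr fun α => (hX α).2

lemma isDynamicMKNFModel_level_iff_of_isProgBased (hK : K.IsProgBased)
    (hβ : ∀ i, (K i).IsLevelMap β) {M : Set (Interp S)} :
    (K.level β α X).IsDynamicMKNFModel M ↔
      ∃ I, IsDynamicStableModel (fun i => ((K i).level β α X).prog) I ∧ M = Set.Ici I :=
  isDynamicMKNFModel_iff_of_isProgBased fun i => Set.subset_empty_iff.1 fun _ hφ =>
    (hK i).subset ((hβ i).level_ont.subset hφ).1

lemma level_iInter_Ici_prog (hβ : ∀ i, (K i).IsLevelMap β) (I : Interp S) (i : Fin n) :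
    ((K i).level β α (⋂ η < α, Set.Ici (I ∩ (fun p => β p.pred) ⁻¹' {η}))).prog =
      levelProgram (fun p => β p.pred) (K i).prog α (withDefaults I) := by
  have hlow : ⋃ η < α, I ∩ (fun p => β p.pred) ⁻¹' {η} = I ∩ (fun p => β p.pred) ⁻¹' Set.Iio α := by
    ext p
    simp [and_comm]
  simp only [← Set.Ici_iSup, Set.iSup_eq_iUnion, hlow, (hβ i).level_Ici_prog]
  exact levelProgram_congr fun L hL => Literal.holds_inter_iff hL

lemma isLevelSolution_Ici_iff [WellFoundedLT ι] (hK : K.IsProgBased)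
    (hβ : ∀ i, (K i).IsLevelMap β) {I : Interp S} :
    K.IsLevelSolution β (fun α => Set.Ici (I ∩ (fun p => β p.pred) ⁻¹' {α})) ↔
      IsDynamicStableModel (fun i => (K i).prog) I := by
  simp only [isDynamicStableModel_iff_forall_level fun i => (hβ i).prog, IsLevelSolution,
    isDynamicMKNFModel_level_iff_of_isProgBased hK hβ, level_iInter_Ici_prog hβ,
    Set.Ici_injective.eq_iff, exists_eq_right']

lemma IsLevelSolution.eq_Ici_inter_level (hK : K.IsProgBased) (hβ : ∀ i, (K i).IsLevelMap β)
    {X : ι → Set (Interp S)} (hX : K.IsLevelSolution β X) :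
    ∃ I : Interp S, X = fun α => Set.Ici (I ∩ (fun p => β p.pred) ⁻¹' {α}) := by
  choose A hA hXA using fun α =>
    (isDynamicMKNFModel_level_iff_of_isProgBased hK hβ).1 (hX α)
  have hAlevel : ∀ α, A α ⊆ (fun p => β p.pred) ⁻¹' {α} := fun α p hp => by
    obtain ⟨i, r, hr, hrp⟩ := (hA α).exists_head hp
    rw [(hβ i).level_prog] at hr
    obtain ⟨r, ⟨-, hα, -⟩, rfl⟩ := hr
    exact (congrArg (β ·.atom.pred) hrp).symm.trans hα
  refine ⟨⋃ α, A α ∩ (fun p => β p.pred) ⁻¹' {α}, funext fun α => ?_⟩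
  rw [iUnion_inter_fiber_inter_fiber, Set.inter_eq_left.2 (hAlevel α), hXA]

lemma isDynamicMKNFModel_iff_exists_isLevelSolution_of_isProgBased [WellFoundedLT ι]
    (hK : K.IsProgBased) (hβ : ∀ i, (K i).IsLevelMap β) {M : Set (Interp S)} :
    K.IsDynamicMKNFModel M ↔ ∃ X, K.IsLevelSolution β X ∧ M = ⋂ α, X α := by
  have hinter : ∀ I : Interp S, ⋂ α, Set.Ici (I ∩ (fun p => β p.pred) ⁻¹' {α}) = Set.Ici I :=
    fun I => by rw [← Set.Ici_iSup, Set.iSup_eq_iUnion, iUnion_inter_fiber]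
  rw [isDynamicMKNFModel_iff_of_isProgBased hK]
  constructor
  · rintro ⟨I, hI, rfl⟩
    exact ⟨_, (isLevelSolution_Ici_iff hK hβ).2 hI, (hinter I).symm⟩
  · rintro ⟨X, hX, rfl⟩
    obtain ⟨I, rfl⟩ := hX.eq_Ici_inter_level hK hβ
    exact ⟨I, (isLevelSolution_Ici_iff hK hβ).1 hX, hinter I⟩

theorem IsBasic.isDynamicMKNFModel_iff_exists_isLevelSolution [WellFoundedLT ι] (hK : K.IsBasic)
    (hβ : ∀ i, (K i).IsLevelMap β) {M : Set (Interp S)} :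
    K.IsDynamicMKNFModel M ↔ M.Nonempty ∧ ∃ X, K.IsLevelSolution β X ∧ M = ⋂ α, X α := by
  rcases hK with hO | hP
  · exact isDynamicMKNFModel_iff_exists_isLevelSolution_of_isOntBased hO hβ
  · rw [← isDynamicMKNFModel_iff_exists_isLevelSolution_of_isProgBased hP hβ]
    exact (and_iff_right_of_imp And.left).symm

end DynamicHybridKB

namespace HybridKB

variable {K : HybridKB D}

lemma isLevelMap_of_forall_isSplittingSet (h : ∀ α, K.IsSplittingSet (β ⁻¹' Set.Iic α)) :
    K.IsLevelMap β where
  ont φ hφ Q hQ Q' hQ' :=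
    le_antisymm ((h (β Q')).1 φ hφ ⟨Q', hQ', le_rfl (a := β Q')⟩ hQ)
      ((h (β Q)).1 φ hφ ⟨Q, hQ, le_rfl (a := β Q)⟩ hQ')
  prog r hr L hL := by
    have hhead : (r.head.preds ∩ β ⁻¹' Set.Iic (β r.head.atom.pred)).Nonempty :=
      ⟨r.head.atom.pred, r.head.preds_eq ▸ rfl, le_rfl (a := β r.head.atom.pred)⟩
    exact (Rule.preds_subset_iff.1 ((h _).2 r hr hhead)).2 L hL

lemma reduct_empty (K : HybridKB D) (X : Set (Interp S)) : K.reduct ∅ X = K := by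
  have hont : ∀ φ, ¬ D.preds φ ⊆ ∅ := fun φ h => (h (D.fo φ).preds_nonempty.some_mem).elim
  have hprog : ∀ r : Rule S, ¬ r.preds ⊆ ∅ := fun r h => (Rule.preds_subset_iff.1 h).1
  have hrule : ∀ r r' : Rule S, r'.head = r.head ∧ r'.body = r.body ↔ r = r' := by
    rintro ⟨H, B⟩ ⟨H', B'⟩
    simp [eq_comm]
  have hmodels : ∀ r : Rule S, Models X (Literal.toMKNF '' {L | L ∈ r.body ∧ L.preds ⊆ ∅}) := by
    simp [Literal.preds_eq, Models]
  simp only [reduct, top, bottom, hont, hprog, hmodels, Set.compl_empty, Set.subset_univ, and_true,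
    true_and, Finset.setOfPred_mem, Finset.coe_inj, hrule, and_false, Set.ofPred_false,
    Set.sdiff_empty, exists_eq_right, Set.ofPred_mem_eq]

lemma level_of_isMin (hα : IsMin α) : K.level β α X = K.bottom (β ⁻¹' Set.Iic α) := by
  rw [level, Set.Iio_eq_empty_iff.2 hα, Set.preimage_empty, reduct_empty]

lemma level_of_covBy {η : ι} (h : η ⋖ α) :
    K.level β α X = (K.bottom (β ⁻¹' Set.Iic α)).reduct (β ⁻¹' Set.Iic η) X := by
  rw [level, h.Iio_eq]

end HybridKB

namespace DynamicHybridKB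

lemma isDynamicMKNFModel_level_iff_of_notMem_range (hα : α ∉ Set.range β) {K : DynamicHybridKB D n}
    {M : Set (Interp S)} : (K.level β α X).IsDynamicMKNFModel M ↔ M = Set.univ := by
  have hlt : β ⁻¹' Set.Iio α = β ⁻¹' Set.Iic α := Set.ext fun Q =>
    (Ne.le_iff_lt fun hQ => hα ⟨Q, hQ⟩).symm
  refine isDynamicMKNFModel_iff_of_forall_empty (fun i => ?_) fun i => ?_
  · rw [level, HybridKB.level, hlt]
    exact Set.subset_empty_iff.1 fun φ hφ => hφ.2 ⟨hφ.1, hφ.1.2⟩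
  · rw [level, HybridKB.level, hlt]
    exact Set.subset_empty_iff.1 fun _ ⟨r, hr, _⟩ => hr.2 ⟨hr.1, hr.1.2⟩

end DynamicHybridKB

end Splitting

/-! ## Splitting sequences as levels -/

section SplittingSequence

variable {S : Signature.{u, v}} {D : DescriptionLogic.{u, v, w} S} {n : ℕ}
variable {μ : Ordinal.{x}} {U : Ordinal.{x} → Set S.Pred} {β : S.Pred → Set.Iio μ}

namespace HybridKB

variable {K : HybridKB D}

lemma IsSplittingSequence.exists_level (hU : K.IsSplittingSequence μ U) :
    ∃ β : S.Pred → Set.Iio μ, ∀ α : Set.Iio μ, U α = β ⁻¹' Set.Iic α := by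
  have hne : ∀ Q : S.Pred, {α : Set.Iio μ | Q ∈ U α}.Nonempty := fun Q => by
    obtain ⟨α, hα, hQ⟩ := Set.mem_iUnion₂.1 (hU.cover ▸ Set.mem_univ Q)
    exact ⟨⟨α, hα⟩, hQ⟩
  choose β hβ hmin using fun Q => WellFounded.has_min (wellFounded_lt (α := Set.Iio μ)) _ (hne Q)
  exact ⟨β, fun α => Set.ext fun Q => ⟨fun hQ => not_lt.1 (hmin Q α hQ),
    fun h => hU.monotone _ _ h α.2 (hβ Q)⟩⟩

lemma IsSplittingSequence.isLevelMap (hU : K.IsSplittingSequence μ U)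
    (hβ : ∀ α : Set.Iio μ, U α = β ⁻¹' Set.Iic α) : K.IsLevelMap β :=
  isLevelMap_of_forall_isSplittingSet fun α => hβ α ▸ hU.splitting α α.2

lemma IsSplittingSequence.notMem_range_level (hU : K.IsSplittingSequence μ U)
    (hβ : ∀ α : Set.Iio μ, U α = β ⁻¹' Set.Iic α) {α : Set.Iio μ}
    (hα : Order.IsSuccLimit (α : Ordinal.{x})) : α ∉ Set.range β := by
  rintro ⟨Q, rfl⟩
  have hQ : Q ∈ ⋃ η < (β Q : Ordinal.{x}), U η := by
    rw [← hU.continuous _ (β Q).2 hα, hβ]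
    exact le_rfl (a := β Q)
  obtain ⟨η, hη, hQ⟩ := Set.mem_iUnion₂.1 hQ
  rw [hβ ⟨η, hη.trans (β Q).2⟩] at hQ
  exact hη.not_ge hQ

end HybridKB

namespace DynamicHybridKB

variable {K : DynamicHybridKB D n} {X : Ordinal.{x} → Set (Interp S)} {M : Set (Interp S)}

lemma level_zero (hβ : ∀ α : Set.Iio μ, U α = β ⁻¹' Set.Iic α) (h : 0 < μ)
    (Y : Set (Interp S)) : K.level β ⟨0, h⟩ Y = K.bottom (U 0) := by
  funext i
  rw [level, HybridKB.level_of_isMin fun _ _ => Subtype.coe_le_coe.1 zero_le, ← hβ]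
  rfl

lemma level_add_one (hβ : ∀ α : Set.Iio μ, U α = β ⁻¹' Set.Iic α) {α : Ordinal.{x}}
    (h : α + 1 < μ) :
    K.level β ⟨α + 1, h⟩ (⋂ η < (⟨α + 1, h⟩ : Set.Iio μ), X η) =
      (K.bottom (U (α + 1))).reduct (U α) (⋂ η ≤ α, X η) := by
  have hlt : α < α + 1 := lt_add_one α
  have hα : α < μ := hlt.trans h
  have hcov : (⟨α, hα⟩ : Set.Iio μ) ⋖ ⟨α + 1, h⟩ :=
    ⟨hlt, fun η hαη hη => (Order.lt_add_one_iff.1 (Subtype.coe_lt_coe.2 hη)).not_gt hαη⟩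
  have hinter : ⋂ η < (⟨α + 1, h⟩ : Set.Iio μ), X η = ⋂ η ≤ α, X η := by
    ext I
    simp only [Set.mem_iInter]
    exact ⟨fun hI η hη => hI ⟨η, hη.trans_lt hα⟩ (Order.lt_add_one_iff.2 hη),
      fun hI η hη => hI η (Order.lt_add_one_iff.1 (Subtype.coe_lt_coe.2 hη))⟩
  funext i
  rw [level, HybridKB.level_of_covBy hcov, ← hβ, ← hβ, hinter]
  rfl

lemma isSolution_iff_isLevelSolution [NeZero n] (hU : K.IsSplittingSequence μ U)
    (hβ : ∀ α : Set.Iio μ, U α = β ⁻¹' Set.Iic α) :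
    K.IsSolution μ U X ↔ K.IsLevelSolution β fun α : Set.Iio μ => X α := by
  have hlimit : ∀ α : Set.Iio μ, Order.IsSuccLimit (α : Ordinal.{x}) → ∀ {Y N},
      (K.level β α Y).IsDynamicMKNFModel N ↔ N = Set.univ := fun α hα =>
    isDynamicMKNFModel_level_iff_of_notMem_range ((hU 0).notMem_range_level hβ hα)
  constructor
  · rintro h ⟨α, hα⟩
    rcases Ordinal.zero_or_succ_or_isSuccLimit α with rfl | ⟨γ, rfl⟩ | hl
    · exact level_zero hβ hα _ ▸ h.zero hα
    · exact level_add_one hβ hα ▸ h.succ γ hα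
    · exact (hlimit ⟨α, hα⟩ hl).2 (h.limit α hα hl)
  · intro h
    exact ⟨fun α hα => (h ⟨α, hα⟩).1, fun h₀ => level_zero hβ h₀ _ ▸ h ⟨0, h₀⟩,
      fun α hα => level_add_one hβ hα ▸ h ⟨α + 1, hα⟩,
      fun α hα hl => (hlimit ⟨α, hα⟩ hl).1 (h ⟨α, hα⟩)⟩

lemma exists_isSolution_iff_exists_isLevelSolution [NeZero n] (hU : K.IsSplittingSequence μ U)
    (hβ : ∀ α : Set.Iio μ, U α = β ⁻¹' Set.Iic α) :
    (∃ X, K.IsSolution μ U X ∧ M = ⋂ α < μ, X α) ↔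
      ∃ X, K.IsLevelSolution β X ∧ M = ⋂ α, X α := by
  have hrestrict : Function.Surjective
      fun (X : Ordinal.{x} → Set (Interp S)) (α : Set.Iio μ) => X α :=
    Subtype.surjective_restrict _
  rw [hrestrict.exists]
  simp only [isSolution_iff_isLevelSolution hU hβ, Set.iInter_subtype]
  rfl

lemma isDynamicMKNFModel_iff_of_length_zero (K : DynamicHybridKB D 0) :
    K.IsDynamicMKNFModel M ↔ M = Set.univ :=
  isDynamicMKNFModel_iff_of_forall_empty (fun i => i.elim0) fun i => i.elim0

lemma isDynamicMKNFModelWrt_iff_of_length_zero (K : DynamicHybridKB D 0) :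
    K.IsDynamicMKNFModelWrt μ U M ↔ M = Set.univ := by
  have hbasic : K.IsBasic := Or.inl fun i => i.elim0
  constructor
  · rintro ⟨-, -, X, hX, rfl⟩
    simp only [Set.iInter_eq_univ]
    intro α hα
    rcases Ordinal.zero_or_succ_or_isSuccLimit α with rfl | ⟨γ, rfl⟩ | hl
    · exact (isDynamicMKNFModel_iff_of_length_zero _).1 (hX.zero hα)
    · exact (isDynamicMKNFModel_iff_of_length_zero _).1 (hX.succ γ hα)
    · exact hX.limit α hα hl
  · rintro rfl
    refine ⟨hbasic.isUpdateEnabling fun i => i.elim0, Set.univ_nonempty, fun _ => Set.univ,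
      ⟨fun _ _ => Set.univ_nonempty, fun _ => ?_, fun _ _ => ?_, fun _ _ _ => rfl⟩, by simp⟩ <;>
    exact (isDynamicMKNFModel_iff_of_length_zero _).2 rfl

end DynamicHybridKB

end SplittingSequence

end HybridMKNF

theorem mainTheorem8 {S : HybridMKNF.Signature.{u, v}}
    {D : HybridMKNF.DescriptionLogic.{u, v, w} S} {n : ℕ}
    (K : HybridMKNF.DynamicHybridKB D n) (hK : K.IsBasic)
    (μ : Ordinal.{x}) (U : Ordinal.{x} → Set S.Pred) (hU : K.IsSplittingSequence μ U)
    (M : Set (HybridMKNF.Interp S)) :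
    K.IsDynamicMKNFModel M ↔ K.IsDynamicMKNFModelWrt μ U M := by
  rcases eq_zero_or_neZero n with rfl | _
  · rw [K.isDynamicMKNFModel_iff_of_length_zero, K.isDynamicMKNFModelWrt_iff_of_length_zero]
  · obtain ⟨β, hβ⟩ := (hU 0).exists_level
    have hlevel : ∀ i, (K i).IsLevelMap β := fun i => (hU i).isLevelMap hβ
    rw [hK.isDynamicMKNFModel_iff_exists_isLevelSolution hlevel,
      HybridMKNF.DynamicHybridKB.IsDynamicMKNFModelWrt, and_iff_right (hK.isUpdateEnabling hU),
      HybridMKNF.DynamicHybridKB.exists_isSolution_iff_exists_isLevelSolution hU hβ]
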